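/- **Setting.** Graphs are finite, simple and undirected, with vertex set $V=\{1,\dots,n\}$. Two graphs on $V$ are *edge-neighboring* if they differ in exactly one edge. The *$k$-core* of $G$ is its maximal induced subgraph of minimum degree at least $k$; the *core number* $k(v)$ is the largest $k$ such that $v$ lies in the $k$-core. Values $\hat k(v)$ are *$(\phi,\zeta)$-approximate core numbers* if $k(v)-\zeta\le \hat k(v)\le \phi\,k(v)+\zeta$ for all $v\in V$. $\mathrm{Lap}(b)$ is the distribution on $\mathbb R$ with density $\frac1{2b}e^{-|x|/b}$. **Local model.** Each node knows only its set of neighbors and private randomness of its own (independent of that of the other nodes), which it keeps during the whole computation. In each round a curator who sees only the public transcript announces which nodes are queried, a randomizer for each of them (a function of its neighborhood and its private randomness) and privacy parameters; the queried nodes' outputs become public; or the curator stops. The transcript consists of all announcements and outputs; its length is the number of rounds. The protocol is *$\varepsilon$-local edge differentially private* if every announced randomizer is a differentially private function of the node's neighborhood (with respect to changing one neighbor) for its announced parameter, and $\Pr[\text{transcript on }G\in E]\le e^{\varepsilon}\Pr[\text{transcript on }G'\in E]$ for all edge-neighboring $G,G'$ and all events $E$. **Algorithm** (parameters $\varepsilon>0$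 and $\eta_0>0$). Let $\psi=0.1\,\eta_0$, $\lambda=\frac{2(30-\eta_0)\eta_0}{(\eta_0+10)^2}$ and $g=4\lceil\log_{1+\psi}n\rceil$. Each node $i$ draws $\tilde\ell(i)\sim\mathrm{Lap}(4/\varepsilon)$ and starts on level $L_0[i]=0$. In round $r=0,1,\dots,g^2-1$, each node $i$ with $L_r[i]=r$ draws a fresh $X\sim\mathrm{Lap}(8/\varepsilon)$, counts the number $\mathcal U_i$ of its neighbors $j$ with $L_r[j]=r$, and releases $A_i=0$ if $\mathcal U_i+X\le(1+\psi)^{\lfloor r/g\rfloor}+\tilde\ell(i)$ and $A_i=1$ otherwise; all other nodes release $A_i=0$. Then $L_{r+1}[i]=L_r[i]+A_i$. Finally, with $\ell'$ the largest level such that $L_{\ell'}[i]=\ell'$, the curator outputs $$\hat k(i)=\tfrac{2+\lambda}{2}\,(1+\psi)^{\max\left(\left\lfloor\frac{\ell'+1}{4\lceil\log_{1+\psi}n\rceil}\right\rfloor-1,\;0\right)} .$$ **Theorem.** Let $\eta>0$ be a constant and run the algorithm with $\eta_0=\min(\eta,5)$. 1. For all $n$ and $\varepsilon>0$ it is $\varepsilon$-local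 edge differentially private. 2. It runs in $O(\log^2 n)$ rounds, with a constant depending only on $\eta$. 3. For every constant $c\ge1$ there are constants $K,C$ depending only on $\eta$ and $c$ such that for all $n\ge2$, all $\varepsilon>0$ and every graph $G$ on $n$ vertices, with probability at least $1-C/n^{c}$ the outputs $\hat k(v)$ are $\left(2+\eta,\;K\max\left(\frac{\log n}{\varepsilon},1\right)\right)$-approximate core numbers of $G$; in particular they are $\left(2+\eta,\,O\left(\frac{\log n}{\varepsilon}\right)\right)$-approximate for $\varepsilon\le\log n$. -/

import Mathlib

open MeasureTheory

noncomputable section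

namespace LEDPCore

/-! ### Core numbers -/

/-- The `k`-core of `G`: the largest vertex set in which every vertex has at least `k` neighbours
(the family of such sets is closed under unions, so the union is the largest one). -/
def kCore {V : Type} (G : SimpleGraph V) (k : ℕ) : Set V :=
  ⋃₀ {S : Set V | ∀ u ∈ S, k ≤ (G.neighborSet u ∩ S).ncard}

/-- The core number of `v`: the largest `k` such that `v` lies in the `k`-core. -/
def coreNumber {V : Type} (G : SimpleGraph V) (v : V) : ℕ :=
  sSup {k : ℕ | v ∈ kCore G k}

/-- `est` is a `(φ, ζ)`-approximation to the core numbers of `G`. -/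
def IsApproxCore {V : Type} (φ ζ : ℝ) (G : SimpleGraph V) (est : V → ℝ) : Prop :=
  ∀ v, (coreNumber G v : ℝ) - ζ ≤ est v ∧ est v ≤ φ * (coreNumber G v : ℝ) + ζ

/-! ### Differential privacy

Randomized algorithms are functions of the input and of a sample point `ω`. All outputs are
discrete, so that events are arbitrary sets of outputs (and have to be measurable events). -/

/-- Two graphs on the same vertex set that differ in exactly one edge. -/
def EdgeNeighboring {V : Type} (G G' : SimpleGraph V) : Prop :=
  (symmDiff G.edgeSet G'.edgeSet).ncard = 1

/-- `A` is an `ε`-differentially private algorithm for the neighbouring relation `nbr`. -/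
def IsDP {I Ω Y : Type} [MeasurableSpace Ω] (nbr : I → I → Prop) (ε : ℝ) (μ : Measure Ω)
    (A : I → Ω → Y) : Prop :=
  (∀ x (E : Set Y), MeasurableSet {ω | A x ω ∈ E}) ∧
  ∀ x x', nbr x x' → ∀ E : Set Y,
    μ {ω | A x ω ∈ E} ≤ ENNReal.ofReal (Real.exp ε) * μ {ω | A x' ω ∈ E}

/-- An `ε`-local randomizer: an `ε`-edge differentially private algorithm whose input is the set of
neighbours of a single node. -/
def IsLocalRandomizer {n : ℕ} {S Y : Type} [MeasurableSpace S] (ε : ℝ) (μ : Measure S)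
    (R : Set (Fin n) → S → Y) : Prop :=
  IsDP (fun a a' => (symmDiff a a').ncard = 1) ε μ R

/-! ### Protocols in the local edge model -/

/-- What the curator announces for one round: the parties that are queried, the randomizer that each
of them has to apply (a function of its neighbourhood and of its private randomness) and the
privacy parameters of the randomizers. -/
structure RoundSpec (n : ℕ) (S Y : Type) where
  parties : Set (Fin n)
  randomizer : Fin n → Set (Fin n) → S → Y
  budget : Fin n → ℝ

/-- One round of a transcript: the announcement together with the outputs of the queried parties. -/
structure RoundRecord (n : ℕ) (S Y : Type) extends RoundSpec n S Y where
  outputs : Fin n → Option Y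

/-- The public record of the rounds played so far, in chronological order. -/
abbrev Transcript (n : ℕ) (S Y : Type) : Type := List (RoundRecord n S Y)

/-- A protocol for `n` nodes. Node `v` holds private randomness (an element of `S` with law
`seedLaw v`, independent of the other nodes), which it keeps during the whole computation. The
curator sees nothing but the transcript; it announces a next round or stops (`none`). -/
structure LocalProtocol (n : ℕ) (S Y : Type) [MeasurableSpace S] where
  seedLaw : Fin n → Measure S
  curator : Transcript n S Y → Option (RoundSpec n S Y)

namespace LocalProtocol

variable {n : ℕ} {S Y : Type} [MeasurableSpace S]

/-- The joint law of the private randomness of all nodes. -/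
def law (P : LocalProtocol n S Y) : Measure (Fin n → S) := Measure.pi P.seedLaw

open Classical in
/-- Playing one announced round: each queried node applies its randomizer to its own neighbourhood
and its own randomness, and the result becomes public. -/
def play (G : SimpleGraph (Fin n)) (ω : Fin n → S) (q : RoundSpec n S Y) : RoundRecord n S Y where
  toRoundSpec := q
  outputs v := if v ∈ q.parties then some (q.randomizer v (G.neighborSet v) (ω v)) else none

/-- The transcript after at most `t` rounds on the graph `G`. -/
def run (P : LocalProtocol n S Y) (G : SimpleGraph (Fin n)) (ω : Fin n → S) :
    ℕ → Transcript n S Y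
  | 0 => []
  | t + 1 =>
    match P.curator (P.run G ω t) with
    | none => P.run G ω t
    | some q => P.run G ω t ++ [play G ω q]

/-- The protocol has always stopped after at most `T` rounds. -/
def HaltsWithin (P : LocalProtocol n S Y) (T : ℕ) : Prop :=
  ∀ G ω, P.curator (P.run G ω T) = none

/-- `ε`-local edge differential privacy: the randomness of the nodes is given by probability
measures, all announced randomizers are local randomizers for the announced privacy parameters, and
the transcript is `ε`-edge differentially private at every time (hence the entire transcript is, for
a protocol that halts). -/
def IsLEDP (P : LocalProtocol n S Y) (ε : ℝ) : Prop :=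
  (∀ v, IsProbabilityMeasure (P.seedLaw v)) ∧
  (∀ π q, P.curator π = some q → ∀ v ∈ q.parties,
    0 ≤ q.budget v ∧ IsLocalRandomizer (q.budget v) (P.seedLaw v) (q.randomizer v)) ∧
  ∀ t, IsDP EdgeNeighboring ε P.law (fun G ω => P.run G ω t)

end LocalProtocol

/-! ### The level algorithm -/

/-- The centered Laplace distribution `Lap(b)`. -/
def laplace (b : ℝ) : Measure ℝ :=
  volume.withDensity (fun x => ENNReal.ofReal (Real.exp (-|x| / b) / (2 * b)))

/-- The parameter `ψ`. -/
def psi (η : ℝ) : ℝ := 0.1 * η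

/-- The parameter `λ`; it satisfies `2 + λ = (2 + η) / (1 + ψ)²`. -/
def lam (η : ℝ) : ℝ := 2 * (30 - η) * η / (η + 10) ^ 2

/-- The number `ℓ = ⌈log_{1+ψ} n⌉`. -/
def logCeil (n : ℕ) (η : ℝ) : ℕ := ⌈Real.logb (1 + psi η) n⌉₊

/-- The number of consecutive levels with the same threshold. -/
def groupSize (n : ℕ) (η : ℝ) : ℕ := 4 * logCeil n η

/-- The number of rounds, `(4ℓ)²`. -/
def numRounds (n : ℕ) (η : ℝ) : ℕ := groupSize n η ^ 2

/-- The threshold `(1+ψ)^⌊r / (4ℓ)⌋` of round `r`. -/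
def threshold (n : ℕ) (η : ℝ) (r : ℕ) : ℝ := (1 + psi η) ^ (r / groupSize n η)

/-- The private randomness of a node: the noise of its threshold and its noises in the rounds. -/
abbrev Seed (n : ℕ) (η : ℝ) : Type := ℝ × (Fin (numRounds n η) → ℝ)

/-- The level of node `i` after the rounds recorded in `π`: the number of rounds in which it
released `1`. In particular, `level (π.take r) i` is the level at the beginning of round `r`. -/
def level {n : ℕ} {S : Type} (π : Transcript n S Bool) (i : Fin n) : ℕ :=
  π.countP (fun e => e.outputs i == some true)

open Classical in
/-- The randomizer of node `i` in round `r = π.length`: if the node is on level `r`, it counts its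
neighbours `j ∈ a` on level `r`, adds noise and releases `1` if the result exceeds its noisy
threshold; otherwise (and whenever it is not on level `r`) it releases `0`. -/
def levelRandomizer (n : ℕ) (η : ℝ) (π : Transcript n (Seed n η) Bool)
    (h : π.length < numRounds n η) (i : Fin n) (a : Set (Fin n)) (s : Seed n η) : Bool :=
  if level π i = π.length then
    decide (threshold n η π.length + s.1 <
      ({j ∈ a | level π j = π.length}.ncard : ℝ) + s.2 ⟨π.length, h⟩)
  else false

/-- The level algorithm as a protocol: threshold noise `Lap(4/ε)`, noise `Lap(8/ε)` in each round,
and all nodes release a bit in each of the rounds `0, …, numRounds n η - 1`. -/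
def kCoreProtocol (n : ℕ) (ε η : ℝ) : LocalProtocol n (Seed n η) Bool where
  seedLaw _ := (laplace (4 / ε)).prod (Measure.pi fun _ => laplace (8 / ε))
  curator π :=
    if h : π.length < numRounds n η then
      some
        { parties := Set.univ
          randomizer := levelRandomizer n η π h
          budget := fun _ => ε }
    else none

/-- The highest level `ℓ'` such that node `i` was on level `ℓ'` at the beginning of round `ℓ'`. -/
def topLevel {n : ℕ} {S : Type} (π : Transcript n S Bool) (i : Fin n) : ℕ :=
  Nat.findGreatest (fun l => level (π.take l) i = l) π.length

/-- The estimate that the curator computes from the final transcript. The truncated subtraction of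
natural numbers is `max (⌊(ℓ'+1) / (4ℓ)⌋ - 1) 0`. -/
def coreEstimate {n : ℕ} {S : Type} (η : ℝ) (π : Transcript n S Bool) (i : Fin n) : ℝ :=
  (2 + lam η) / 2 * (1 + psi η) ^ ((topLevel π i + 1) / (4 * logCeil n η) - 1)

/-- The approximate core numbers that the algorithm outputs on the graph `G`. -/
def kCoreOutput (n : ℕ) (ε η : ℝ) (G : SimpleGraph (Fin n)) (ω : Fin n → Seed n η) : Fin n → ℝ :=
  coreEstimate η ((kCoreProtocol n ε η).run G ω (numRounds n η))

end LEDPCore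

end

/-!
Privacy. Given the transcript, the answers of one node amount to comparisons of its neighbour counts
plus fresh noise with thresholds that share one noise. These end with the first answer `0`, so
shifting the shared noise by the sensitivity `1` and the noise of that single round by `2` accounts
for one changed neighbour and costs a factor `exp (ε / 2)`; an edge affects two nodes.

Accuracy. With high probability every comparison is correct up to `D = O(log n / ε)`. Then the
`k`-core survives all rounds with threshold below `k - D`. Conversely, the vertices of a set outside
the `(k + 1)`-core can be peeled off with at most `k` edges each, so a round whose threshold exceeds
`2γk + D` shrinks the part of the surviving set outside the core by a factor `γ`; with
`γ = (1 + ψ)²`, the rounds with a common threshold suffice to exhaust it.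
-/

namespace LEDPCore

/-! ### Product measures and densities -/

section Density

variable {α β : Type*} [MeasurableSpace α] [MeasurableSpace β] {μ : Measure α} {ν : Measure β}

lemma map_withDensity_of_measurePreserving {e : α ≃ᵐ β} (he : MeasurePreserving e μ ν)
    (f : α → ENNReal) : (μ.withDensity f).map e = ν.withDensity (f ∘ e.symm) := by
  ext s hs
  rw [e.map_apply, withDensity_apply _ (e.measurable hs), withDensity_apply _ hs,
    ← he.setLIntegral_comp_preimage_emb e.measurableEmbedding]
  simp only [Function.comp_apply, e.symm_apply_apply]

end Density

section Pi

variable {ι : Type*} [Fintype ι] {X : ι → Type*} [∀ i, MeasurableSpace (X i)]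
  {μ ν : ∀ i, Measure (X i)}

lemma pi_mono [∀ i, SigmaFinite (μ i)] (h : ∀ i, μ i ≤ ν i) : Measure.pi μ ≤ Measure.pi ν := by
  have houter : (Measure.pi μ).toOuterMeasure ≤ OuterMeasure.pi fun i => (ν i).toOuterMeasure :=
    OuterMeasure.le_pi.2 fun s _ => (Measure.pi_pi μ s).trans_le <|
      Finset.prod_le_prod' fun i _ => h i (s i)
  refine Measure.le_iff.2 fun s hs => ?_
  rw [Measure.pi_def ν, toMeasure_apply _ (Measure.pi_caratheodory ν) hs]
  exact houter s

lemma pi_smul [∀ i, SigmaFinite (ν i)] (c : ι → NNReal) :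
    Measure.pi (fun i => c i • ν i) = (∏ i, c i) • Measure.pi ν := by
  refine Measure.pi_eq fun s _ => ?_
  simp only [Measure.smul_apply, Measure.pi_pi, ENNReal.smul_def, smul_eq_mul,
    Finset.prod_mul_distrib, ENNReal.ofNNReal_finsetProd]

lemma pi_iUnion_eval_preimage_le [∀ i, IsProbabilityMeasure (μ i)] (s : ∀ i, Set (X i)) :
    Measure.pi μ (⋃ i, Function.eval i ⁻¹' s i) ≤ ∑ i, μ i (s i) := by
  refine (measure_iUnion_fintype_le _ _).trans (Finset.sum_le_sum fun i _ => ?_)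
  simpa using (measurePreserving_eval μ i).measure_preimage_le (s i)

end Pi

/-! ### The Laplace distribution -/

lemma measurable_laplaceDensity (b : ℝ) :
    Measurable fun x : ℝ => ENNReal.ofReal (Real.exp (-|x| / b) / (2 * b)) := by
  fun_prop

lemma map_neg_laplace (b : ℝ) : (laplace b).map (fun x => -x) = laplace b := by
  have h := map_withDensity_of_measurePreserving (e := MeasurableEquiv.neg ℝ)
    (Measure.measurePreserving_neg volume)
    fun x => ENNReal.ofReal (Real.exp (-|x| / b) / (2 * b))
  simpa [laplace, Function.comp_def] using h

lemma laplace_Ioi {b c : ℝ} (hb : 0 < b) (hc : 0 ≤ c) :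
    laplace b (Set.Ioi c) = ENNReal.ofReal (Real.exp (-c / b) / 2) := by
  have hrate : -b⁻¹ < 0 := neg_lt_zero.2 (inv_pos.2 hb)
  have hdensity : ∀ x ∈ Set.Ioi c, ENNReal.ofReal (Real.exp (-|x| / b) / (2 * b)) =
      ENNReal.ofReal (Real.exp (-b⁻¹ * x) / (2 * b)) := fun x hx => by
    rw [abs_of_pos (hc.trans_lt hx), neg_div, neg_mul, ← div_eq_inv_mul]
  rw [laplace, withDensity_apply _ measurableSet_Ioi,
    setLIntegral_congr_fun measurableSet_Ioi hdensity, ← ofReal_integral_eq_lintegral_ofReal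
      ((integrableOn_exp_mul_Ioi hrate c).div_const _) (ae_of_all _ fun x => by positivity),
    integral_div, integral_exp_mul_Ioi hrate, neg_mul, ← div_eq_inv_mul, neg_div]
  congr 1
  field_simp

lemma laplace_setOf_lt_abs {b c : ℝ} (hb : 0 < b) (hc : 0 ≤ c) :
    laplace b {x | c < |x|} = ENNReal.ofReal (Real.exp (-c / b)) := by
  have hsplit : {x : ℝ | c < |x|} = Set.Ioi c ∪ (fun x => -x) ⁻¹' Set.Ioi c := by
    ext x
    exact (lt_abs : c < |x| ↔ c < x ∨ c < -x)
  have hdisj : Disjoint (Set.Ioi c) ((fun x : ℝ => -x) ⁻¹' Set.Ioi c) :=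
    Set.disjoint_left.2 fun x (hx : c < x) (hx' : c < -x) => by linarith
  rw [hsplit, measure_union hdisj (measurable_neg measurableSet_Ioi),
    ← Measure.map_apply measurable_neg measurableSet_Ioi, map_neg_laplace, laplace_Ioi hb hc,
    ← ENNReal.ofReal_add (by positivity) (by positivity), add_halves]

lemma isProbabilityMeasure_laplace {b : ℝ} (hb : 0 < b) : IsProbabilityMeasure (laplace b) := by
  have hzero : laplace b {0} = 0 :=
    withDensity_absolutelyContinuous _ _ Real.volume_singleton
  have hcompl : ({0}ᶜ : Set ℝ) = {x | 0 < |x|} := by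
    ext x
    simp
  refine ⟨?_⟩
  rw [← measure_add_measure_compl (measurableSet_singleton 0), hzero, hcompl,
    laplace_setOf_lt_abs hb le_rfl]
  simp

lemma map_sub_laplace_le {b : ℝ} (hb : 0 < b) (d : ℝ) :
    (laplace b).map (fun x => x - d) ≤ (Real.exp (|d| / b)).toNNReal • laplace b := by
  have h := map_withDensity_of_measurePreserving (e := MeasurableEquiv.subRight d)
    (measurePreserving_sub_right volume d)
    fun x => ENNReal.ofReal (Real.exp (-|x| / b) / (2 * b))
  change (laplace b).map (fun x => x - d) = _ at h
  rw [h, laplace, ENNReal.smul_def, ← withDensity_smul _ (measurable_laplaceDensity b)]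
  refine withDensity_mono (ae_of_all _ fun x => ?_)
  change ENNReal.ofReal (Real.exp (-|x + d| / b) / (2 * b)) ≤
    ENNReal.ofReal (Real.exp (|d| / b)) * ENNReal.ofReal (Real.exp (-|x| / b) / (2 * b))
  rw [← ENNReal.ofReal_mul (by positivity), ← mul_div_assoc, ← Real.exp_add, ← add_div]
  gcongr
  linarith [abs_sub_abs_le_abs_sub x (x + d), show |x - (x + d)| = |d| by simp]

/-! ### Differential privacy of transcripts -/

lemma isDP_of_forall_fiber {I Ω Y : Type} [MeasurableSpace Ω] {nbr : I → I → Prop} {ε : ℝ}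
    {μ : Measure Ω} {A : I → Ω → Y} (hcount : ∀ x, (Set.range (A x)).Countable)
    (hmeas : ∀ x y, MeasurableSet {ω | A x ω = y})
    (hle : ∀ x x', nbr x x' → ∀ ω₀,
      μ {ω | A x ω = A x ω₀} ≤ ENNReal.ofReal (Real.exp ε) * μ {ω | A x' ω = A x ω₀}) :
    IsDP nbr ε μ A := by
  have hevent : ∀ x (E : Set Y), {ω | A x ω ∈ E} = A x ⁻¹' (E ∩ Set.range (A x)) :=
    fun x E => Set.preimage_inter_range.symm
  have hE : ∀ x (E : Set Y), (E ∩ Set.range (A x)).Countable :=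
    fun x E => (hcount x).mono Set.inter_subset_right
  refine ⟨fun x E => ?_, fun x x' hx E => ?_⟩
  · rw [hevent, ← Set.biUnion_preimage_singleton]
    exact .biUnion (hE x E) fun y _ => hmeas x y
  · calc μ {ω | A x ω ∈ E}
        = ∑' y : ↥(E ∩ Set.range (A x)), μ (A x ⁻¹' {(y : Y)}) := by
          rw [hevent, tsum_measure_preimage_singleton (hE x E) fun y _ => hmeas x y]
      _ ≤ ∑' y : ↥(E ∩ Set.range (A x)),
            ENNReal.ofReal (Real.exp ε) * μ (A x' ⁻¹' {(y : Y)}) := by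
          refine ENNReal.tsum_le_tsum ?_
          rintro ⟨_, -, ω₀, rfl⟩
          exact hle x x' hx ω₀
      _ = ENNReal.ofReal (Real.exp ε) * μ (A x' ⁻¹' (E ∩ Set.range (A x))) := by
          rw [ENNReal.tsum_mul_left,
            tsum_measure_preimage_singleton (hE x E) fun y _ => hmeas x' y]
      _ ≤ ENNReal.ofReal (Real.exp ε) * μ {ω | A x' ω ∈ E} := by
          gcongr
          exact fun _ h => h.1

lemma EdgeNeighboring.exists_pair {V : Type} {G G' : SimpleGraph V} (h : EdgeNeighboring G G') :
    ∃ u w : V, u ≠ w ∧ (symmDiff (G.neighborSet u) (G'.neighborSet u)).ncard = 1 ∧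
      (symmDiff (G.neighborSet w) (G'.neighborSet w)).ncard = 1 ∧
      ∀ v, v ≠ u → v ≠ w → G.neighborSet v = G'.neighborSet v := by
  obtain ⟨e, he⟩ := Set.ncard_eq_one.1 h
  induction e using Sym2.ind with
  | _ u w =>
  have hadj : ∀ x y, (G.Adj x y ∧ ¬ G'.Adj x y ∨ G'.Adj x y ∧ ¬ G.Adj x y) ↔
      s(x, y) = s(u, w) := fun x y => by
    rw [← Set.mem_singleton_iff, ← he, Set.mem_symmDiff]
    simp only [SimpleGraph.mem_edgeSet]
  have hne : u ≠ w := by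
    rintro rfl
    simpa using (hadj u u).2 rfl
  refine ⟨u, w, hne, ?_, ?_, fun v hu hw => ?_⟩
  · refine Set.ncard_eq_one.2 ⟨w, Set.ext fun x => ?_⟩
    simpa [Set.mem_symmDiff, hne] using hadj u x
  · refine Set.ncard_eq_one.2 ⟨u, Set.ext fun x => ?_⟩
    simpa [Set.mem_symmDiff, hne.symm] using hadj w x
  · ext x
    have hx := hadj v x
    simp only [Sym2.eq_iff, hu, hw, false_and, or_self, iff_false] at hx
    simp only [SimpleGraph.mem_neighborSet]
    tauto

lemma EdgeNeighboring.prod_le {n : ℕ} {G G' : SimpleGraph (Fin n)} (h : EdgeNeighboring G G')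
    {ε : ℝ} {F : Fin n → Set (Fin n) → ENNReal}
    (hF : ∀ v a a', (symmDiff a a').ncard = 1 →
      F v a ≤ ENNReal.ofReal (Real.exp (ε / 2)) * F v a') :
    ∏ v, F v (G.neighborSet v) ≤
      ENNReal.ofReal (Real.exp ε) * ∏ v, F v (G'.neighborSet v) := by
  obtain ⟨u, w, hne, hu, hw, hrest⟩ := h.exists_pair
  have hfactor : ENNReal.ofReal (Real.exp ε) =
      ∏ v, if v ∈ ({u, w} : Finset (Fin n)) then ENNReal.ofReal (Real.exp (ε / 2)) else 1 := by
    rw [Finset.prod_ite_mem, Finset.univ_inter, Finset.prod_const, Finset.card_pair hne, sq,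
      ← ENNReal.ofReal_mul (by positivity), ← Real.exp_add, add_halves]
  rw [hfactor, ← Finset.prod_mul_distrib]
  refine Finset.prod_le_prod' fun v _ => ?_
  by_cases hv : v = u ∨ v = w
  · rw [if_pos (by simpa using hv)]
    exact hF v _ _ (by rcases hv with rfl | rfl <;> assumption)
  · rw [if_neg (by simpa using hv), one_mul]
    rw [not_or] at hv
    rw [hrest v hv.1 hv.2]

namespace LocalProtocol

variable {n : ℕ} {S Y : Type}

lemma play_eq_play_iff {G G₀ : SimpleGraph (Fin n)} {ω ω₀ : Fin n → S} {q : RoundSpec n S Y} :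
    play G ω q = play G₀ ω₀ q ↔ ∀ v ∈ q.parties, q.randomizer v (G.neighborSet v) (ω v) =
      q.randomizer v (G₀.neighborSet v) (ω₀ v) := by
  simp only [play, RoundRecord.mk.injEq, true_and, funext_iff]
  refine forall_congr' fun v => ?_
  by_cases hv : v ∈ q.parties <;> simp [hv]

variable [MeasurableSpace S]

section Run

variable (P : LocalProtocol n S Y) (G : SimpleGraph (Fin n)) (ω : Fin n → S)

variable {P G ω} in
lemma run_succ_of_none {t : ℕ} (h : P.curator (P.run G ω t) = none) :
    P.run G ω (t + 1) = P.run G ω t := by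
  rw [run, h]

variable {P G ω} in
lemma run_succ_of_some {t : ℕ} {q : RoundSpec n S Y} (h : P.curator (P.run G ω t) = some q) :
    P.run G ω (t + 1) = P.run G ω t ++ [play G ω q] := by
  rw [run, h]

lemma length_run_le (t : ℕ) : (P.run G ω t).length ≤ t := by
  induction t with
  | zero => exact le_rfl
  | succ t ih =>
    cases h : P.curator (P.run G ω t) with
    | none =>
      rw [run_succ_of_none h]
      exact ih.trans t.le_succ
    | some q =>
      rw [run_succ_of_some h, List.length_append]
      exact Nat.succ_le_succ ih

lemma length_run_eq_or_curator_eq_none (t : ℕ) :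
    (P.run G ω t).length = t ∨ P.curator (P.run G ω t) = none := by
  induction t with
  | zero => exact Or.inl rfl
  | succ t ih =>
    cases h : P.curator (P.run G ω t) with
    | none => exact Or.inr (by rw [run_succ_of_none h, h])
    | some q =>
      refine Or.inl ?_
      rw [run_succ_of_some h, List.length_append, ih.resolve_right (by simp [h])]
      rfl

lemma take_run {r t : ℕ} (hrt : r ≤ t) : (P.run G ω t).take r = P.run G ω r := by
  induction t, hrt using Nat.le_induction with
  | base => exact List.take_of_length_le (P.length_run_le G ω r)
  | succ t hrt ih =>
    cases h : P.curator (P.run G ω t) with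
    | none => rw [run_succ_of_none h, ih]
    | some q =>
      have hlen := (P.length_run_eq_or_curator_eq_none G ω t).resolve_right (by simp [h])
      rw [run_succ_of_some h, List.take_append_of_le_length (hrt.trans_eq hlen.symm), ih]

lemma countable_range_run [Countable Y] (t : ℕ) :
    (Set.range fun ω => P.run G ω t).Countable := by
  induction t with
  | zero => exact (Set.countable_singleton []).mono (Set.range_subset_iff.2 fun _ => rfl)
  | succ t ih =>
    let extend (π : Transcript n S Y) (o : Fin n → Option Y) : Transcript n S Y :=
      match P.curator π with
      | none => π
      | some q => π ++ [⟨q, o⟩]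
    refine (ih.image2 (Set.to_countable Set.univ) extend).mono (Set.range_subset_iff.2 fun ω => ?_)
    cases h : P.curator (P.run G ω t) with
    | none => exact ⟨_, ⟨ω, rfl⟩, fun _ => none, trivial, by simp [extend, run_succ_of_none h, h]⟩
    | some q =>
      exact ⟨_, ⟨ω, rfl⟩, (play G ω q).outputs, trivial,
        by simp [extend, run_succ_of_some h, h, play]⟩

end Run

/-- The seeds with which node `v` on the neighbourhood `a` gives the same answers to the queries of
the first `t` rounds as it does in the run on `G₀` with randomness `ω₀`. The announcements are those
of that run, so that the condition for `v` does not involve the seeds of the other nodes. -/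
def consistentSeeds (P : LocalProtocol n S Y) (G₀ : SimpleGraph (Fin n)) (ω₀ : Fin n → S) (t : ℕ)
    (v : Fin n) (a : Set (Fin n)) : Set S :=
  {s | ∀ r < t, ∀ q, P.curator (P.run G₀ ω₀ r) = some q → v ∈ q.parties →
    q.randomizer v a s = q.randomizer v (G₀.neighborSet v) (ω₀ v)}

variable {P : LocalProtocol n S Y} {G G₀ : SimpleGraph (Fin n)} {ω ω₀ : Fin n → S} {t : ℕ}

lemma run_succ_eq_run_succ_iff : P.run G ω (t + 1) = P.run G₀ ω₀ (t + 1) ↔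
    P.run G ω t = P.run G₀ ω₀ t ∧
      ∀ q, P.curator (P.run G₀ ω₀ t) = some q → play G ω q = play G₀ ω₀ q := by
  have hprefix : P.run G ω (t + 1) = P.run G₀ ω₀ (t + 1) → P.run G ω t = P.run G₀ ω₀ t :=
    fun h => by rw [← P.take_run G ω t.le_succ, h, P.take_run G₀ ω₀ t.le_succ]
  refine (and_iff_right_of_imp hprefix).symm.trans (and_congr_right fun h => ?_)
  cases hq : P.curator (P.run G₀ ω₀ t) with
  | none => simp [run_succ_of_none hq, run_succ_of_none (h ▸ hq), h]
  | some q => simp [run_succ_of_some hq, run_succ_of_some (h ▸ hq), h]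

lemma run_eq_run_iff : P.run G ω t = P.run G₀ ω₀ t ↔
    ∀ v, ω v ∈ P.consistentSeeds G₀ ω₀ t v (G.neighborSet v) := by
  induction t with
  | zero => simp [run, consistentSeeds]
  | succ t ih =>
    simp only [run_succ_eq_run_succ_iff, ih, play_eq_play_iff, consistentSeeds, Set.mem_ofPred_eq,
      Nat.forall_lt_succ_right, forall_and]
    exact and_congr_right fun _ => ⟨fun h v q hq => h q hq v, fun h q hq v => h v q hq⟩

lemma setOf_run_eq_run : {ω | P.run G ω t = P.run G₀ ω₀ t} =
    Set.univ.pi fun v => P.consistentSeeds G₀ ω₀ t v (G.neighborSet v) := by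
  ext ω
  simp [run_eq_run_iff]

lemma isDP_run [Countable Y] [∀ v, SigmaFinite (P.seedLaw v)] {ε : ℝ}
    (hmeas : ∀ G₀ ω₀ v a, MeasurableSet (P.consistentSeeds G₀ ω₀ t v a))
    (hle : ∀ G₀ ω₀ v a a', (symmDiff a a').ncard = 1 →
      P.seedLaw v (P.consistentSeeds G₀ ω₀ t v a) ≤
        ENNReal.ofReal (Real.exp (ε / 2)) * P.seedLaw v (P.consistentSeeds G₀ ω₀ t v a')) :
    IsDP EdgeNeighboring ε P.law (fun G ω => P.run G ω t) := by
  refine isDP_of_forall_fiber (fun G => P.countable_range_run G t) (fun G π => ?_)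
    fun G G' hG ω₀ => ?_
  · by_cases hπ : ∃ ω₀, P.run G ω₀ t = π
    · obtain ⟨ω₀, rfl⟩ := hπ
      rw [setOf_run_eq_run]
      exact .univ_pi fun v => hmeas G ω₀ v _
    · simp [not_exists.1 hπ]
  · simp only [setOf_run_eq_run, law, Measure.pi_pi]
    exact hG.prod_le (hle G ω₀)

end LocalProtocol

/-! ### Noisy comparisons with a common noisy threshold -/

section Comparison

variable {ι : Type*}

/-- The law of the noise of a sequence of noisy threshold comparisons: the noise `Lap(b₁)` of the
common threshold and independent noises `Lap(b₂)` of the queries. -/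
noncomputable abbrev noiseLaw (ι : Type*) [Fintype ι] (b₁ b₂ : ℝ) : Measure (ℝ × (ι → ℝ)) :=
  (laplace b₁).prod (Measure.pi fun _ => laplace b₂)

/-- The noises for which the noisy queries `c r` exceed the noisy thresholds `θ r` for `r ∈ above`
and do not exceed them for `r ∈ below`. -/
def comparisonEvent (θ c : ι → ℝ) (above below : Set ι) : Set (ℝ × (ι → ℝ)) :=
  {s | (∀ r ∈ above, θ r + s.1 < c r + s.2 r) ∧ ∀ r ∈ below, c r + s.2 r ≤ θ r + s.1}

lemma measurableSet_comparisonEvent [Countable ι] (θ c : ι → ℝ) (above below : Set ι) :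
    MeasurableSet (comparisonEvent θ c above below) := by
  have heq : comparisonEvent θ c above below =
      (⋂ r ∈ above, {s | θ r + s.1 < c r + s.2 r}) ∩
        ⋂ r ∈ below, {s | c r + s.2 r ≤ θ r + s.1} := by
    ext s
    simp [comparisonEvent]
  rw [heq]
  refine .inter ?_ ?_
  · exact .biInter above.to_countable fun r _ => measurableSet_lt (by fun_prop) (by fun_prop)
  · exact .biInter below.to_countable fun r _ => measurableSet_le (by fun_prop) (by fun_prop)

lemma sub_mem_comparisonEvent {θ c c' : ι → ℝ} {above below : Set ι}
    (hdisj : Disjoint above below) (hc : ∀ r, |c r - c' r| ≤ 1) {s : ℝ × (ι → ℝ)}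
    (hs : s ∈ comparisonEvent θ c above below) :
    (s.1 - 1, fun r => s.2 r - below.indicator 2 r) ∈ comparisonEvent θ c' above below := by
  refine ⟨fun r hr => ?_, fun r hr => ?_⟩
  · have h := hs.1 r hr
    simp only [Set.indicator_of_notMem (hdisj.notMem_of_mem_left hr)]
    linarith [(abs_le.1 (hc r)).2]
  · have h := hs.2 r hr
    simp only [Set.indicator_of_mem hr, Pi.ofNat_apply]
    linarith [(abs_le.1 (hc r)).1]

variable [Fintype ι] {b₁ b₂ : ℝ}

lemma isProbabilityMeasure_noiseLaw (hb₁ : 0 < b₁) (hb₂ : 0 < b₂) :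
    IsProbabilityMeasure (noiseLaw ι b₁ b₂) := by
  have := isProbabilityMeasure_laplace hb₁
  have := isProbabilityMeasure_laplace hb₂
  infer_instance

lemma map_sub_pi_laplace_le (hb₂ : 0 < b₂) (d : ι → ℝ) :
    (Measure.pi fun _ : ι => laplace b₂).map (fun y r => y r - d r) ≤
      (∏ r, (Real.exp (|d r| / b₂)).toNNReal) • Measure.pi fun _ : ι => laplace b₂ := by
  have := isProbabilityMeasure_laplace hb₂
  have : ∀ r, IsProbabilityMeasure ((laplace b₂).map fun x => x - d r) := fun r =>
    Measure.isProbabilityMeasure_map (by fun_prop)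
  rw [Measure.pi_map_pi (f := fun r x => x - d r) fun r => by fun_prop, ← pi_smul]
  exact pi_mono fun r => map_sub_laplace_le hb₂ (d r)

lemma map_sub_noiseLaw_le (hb₁ : 0 < b₁) (hb₂ : 0 < b₂) (x : ℝ) (d : ι → ℝ) :
    (noiseLaw ι b₁ b₂).map (fun s => (s.1 - x, fun r => s.2 r - d r)) ≤
      ENNReal.ofReal (Real.exp (|x| / b₁ + ∑ r, |d r| / b₂)) • noiseLaw ι b₁ b₂ := by
  have := isProbabilityMeasure_laplace hb₁
  have := isProbabilityMeasure_laplace hb₂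
  have hfactor : Real.toNNReal (Real.exp (|x| / b₁ + ∑ r, |d r| / b₂)) =
      (Real.exp (|x| / b₁)).toNNReal * ∏ r, (Real.exp (|d r| / b₂)).toNNReal := by
    rw [Real.exp_add, Real.exp_sum, Real.toNNReal_mul (by positivity),
      Real.toNNReal_prod_of_nonneg fun _ _ => by positivity]
  calc (noiseLaw ι b₁ b₂).map (Prod.map (fun y => y - x) fun y r => y r - d r)
      = ((laplace b₁).map fun y => y - x).prod
          ((Measure.pi fun _ => laplace b₂).map fun y r => y r - d r) :=
        (Measure.map_prod_map _ _ (by fun_prop) (by fun_prop)).symm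
    _ ≤ ((Real.exp (|x| / b₁)).toNNReal • laplace b₁).prod
          ((∏ r, (Real.exp (|d r| / b₂)).toNNReal) • Measure.pi fun _ => laplace b₂) :=
        Measure.prod_mono (map_sub_laplace_le hb₁ x) (map_sub_pi_laplace_le hb₂ d)
    _ = _ := by
        rw [Measure.prod_smul_left, Measure.prod_smul_right, smul_smul, ← hfactor]
        rfl

/-- Lowering the threshold noise by `1` absorbs the change of all queries in `above` at once; only
the queries in `below` have to be shifted one by one. -/
lemma noiseLaw_comparisonEvent_le (hb₁ : 0 < b₁) (hb₂ : 0 < b₂) {θ c c' : ι → ℝ}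
    {above below : Set ι} (hdisj : Disjoint above below) (hc : ∀ r, |c r - c' r| ≤ 1) :
    noiseLaw ι b₁ b₂ (comparisonEvent θ c above below) ≤
      ENNReal.ofReal (Real.exp (1 / b₁ + below.ncard * (2 / b₂))) *
        noiseLaw ι b₁ b₂ (comparisonEvent θ c' above below) := by
  classical
  have hcost : |(1 : ℝ)| / b₁ + ∑ r, |below.indicator 2 r| / b₂ =
      1 / b₁ + below.ncard * (2 / b₂) := by
    simp [Set.indicator_apply, apply_ite abs, ite_div, Set.ncard_eq_toFinset_card',
      Set.toFinset_card, Fintype.card_subtype, ← Finset.sum_filter]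
  calc noiseLaw ι b₁ b₂ (comparisonEvent θ c above below)
      ≤ (noiseLaw ι b₁ b₂).map (fun s => (s.1 - 1, fun r => s.2 r - below.indicator 2 r))
          (comparisonEvent θ c' above below) := by
        rw [Measure.map_apply (by fun_prop) (measurableSet_comparisonEvent ..)]
        exact measure_mono fun s hs => sub_mem_comparisonEvent hdisj hc hs
    _ ≤ _ := by
        rw [← hcost]
        exact map_sub_noiseLaw_le hb₁ hb₂ 1 _ _

lemma noiseLaw_comparisonEvent_le_of_subsingleton {ε : ℝ} (hε : 0 < ε) {θ c c' : ι → ℝ}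
    {above below : Set ι} (hdisj : Disjoint above below) (hc : ∀ r, |c r - c' r| ≤ 1)
    (hbelow : below.Subsingleton) :
    noiseLaw ι (4 / ε) (8 / ε) (comparisonEvent θ c above below) ≤
      ENNReal.ofReal (Real.exp (ε / 2)) *
        noiseLaw ι (4 / ε) (8 / ε) (comparisonEvent θ c' above below) := by
  have hcard : (below.ncard : ℝ) ≤ 1 := by
    exact_mod_cast Set.ncard_le_one_iff_subsingleton.2 hbelow
  refine (noiseLaw_comparisonEvent_le (by positivity) (by positivity) hdisj hc).trans ?_
  gcongr
  calc 1 / (4 / ε) + below.ncard * (2 / (8 / ε))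
      ≤ 1 / (4 / ε) + 1 * (2 / (8 / ε)) := by gcongr
    _ = ε / 2 := by
        field_simp
        norm_num

lemma noiseLaw_exists_lt_abs_le (hb₁ : 0 < b₁) (hb₂ : 0 < b₂) {B : ℝ} (hB : 0 ≤ B) :
    noiseLaw ι b₁ b₂ {s | B < |s.1| ∨ ∃ r, B < |s.2 r|} ≤
      ENNReal.ofReal (Real.exp (-B / b₁) + Fintype.card ι * Real.exp (-B / b₂)) := by
  have := isProbabilityMeasure_laplace hb₁
  have := isProbabilityMeasure_laplace hb₂
  have hunion : {s : ℝ × (ι → ℝ) | B < |s.1| ∨ ∃ r, B < |s.2 r|} =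
      Prod.fst ⁻¹' {x | B < |x|} ∪
        Prod.snd ⁻¹' ⋃ r, Function.eval r ⁻¹' {x | B < |x|} := by
    ext s
    simp
  calc noiseLaw ι b₁ b₂ {s | B < |s.1| ∨ ∃ r, B < |s.2 r|}
      ≤ noiseLaw ι b₁ b₂ (Prod.fst ⁻¹' {x | B < |x|}) +
          noiseLaw ι b₁ b₂ (Prod.snd ⁻¹' ⋃ r, Function.eval r ⁻¹' {x | B < |x|}) :=
        hunion ▸ measure_union_le _ _
    _ ≤ laplace b₁ {x | B < |x|} +
          Measure.pi (fun _ => laplace b₂) (⋃ r : ι, Function.eval r ⁻¹' {x | B < |x|}) :=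
        add_le_add (measurePreserving_fst.measure_preimage_le _)
          (measurePreserving_snd.measure_preimage_le _)
    _ ≤ laplace b₁ {x | B < |x|} + ∑ _r : ι, laplace b₂ {x | B < |x|} := by
        gcongr
        exact pi_iUnion_eval_preimage_le _
    _ = _ := by
        rw [laplace_setOf_lt_abs hb₁ hB, laplace_setOf_lt_abs hb₂ hB, Finset.sum_const,
          Finset.card_univ, nsmul_eq_mul, ENNReal.ofReal_add (by positivity) (by positivity),
          ENNReal.ofReal_mul (by positivity), ENNReal.ofReal_natCast]

end Comparison

open LocalProtocol

/-! ### Privacy of the level algorithm -/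

section Privacy

lemma abs_ncard_inter_sub_ncard_inter_le {α : Type*} [Finite α] (a a' L : Set α) :
    |((a ∩ L).ncard : ℝ) - (a' ∩ L).ncard| ≤ (symmDiff a a').ncard := by
  have hle : ∀ a a' : Set α, (a ∩ L).ncard ≤ (symmDiff a a').ncard + (a' ∩ L).ncard :=
    fun a a' => (Set.ncard_le_ncard (fun x hx => by
      simp only [Set.mem_union, Set.mem_symmDiff, Set.mem_inter_iff] at hx ⊢
      tauto) (Set.toFinite _)).trans (Set.ncard_union_le _ _)
  rw [abs_sub_le_iff, sub_le_iff_le_add, sub_le_iff_le_add]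
  exact ⟨mod_cast hle a a', mod_cast symmDiff_comm a a' ▸ hle a' a⟩

lemma curator_kCoreProtocol_eq_some_iff {n : ℕ} {ε η : ℝ} {π : Transcript n (Seed n η) Bool}
    {q : RoundSpec n (Seed n η) Bool} : (kCoreProtocol n ε η).curator π = some q ↔
      ∃ h : π.length < numRounds n η, q = ⟨Set.univ, levelRandomizer n η π h, fun _ => ε⟩ := by
  simp only [kCoreProtocol]
  split_ifs with h
  · simp [h, eq_comm]
  · simp [h]

lemma curator_kCoreProtocol_eq_none_iff {n : ℕ} {ε η : ℝ} {π : Transcript n (Seed n η) Bool} :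
    (kCoreProtocol n ε η).curator π = none ↔ numRounds n η ≤ π.length := by
  simp [kCoreProtocol]

lemma levelRandomizer_eq_true_iff {n : ℕ} {η : ℝ} {π : Transcript n (Seed n η) Bool}
    {h : π.length < numRounds n η} {i : Fin n} {a : Set (Fin n)} {s : Seed n η} :
    levelRandomizer n η π h i a s = true ↔ level π i = π.length ∧
      threshold n η π.length + s.1 <
        ((a ∩ {j | level π j = π.length}).ncard : ℝ) + s.2 ⟨π.length, h⟩ := by
  unfold levelRandomizer
  split_ifs with hi
  · simp only [decide_eq_true_iff, hi, true_and]
    rfl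
  · simp [hi]

lemma setOf_levelRandomizer_eq {n : ℕ} {η : ℝ} {π : Transcript n (Seed n η) Bool}
    (h : π.length < numRounds n η) {i : Fin n} (hi : level π i = π.length) (a : Set (Fin n))
    (b : Bool) : {s | levelRandomizer n η π h i a s = b} =
      comparisonEvent (fun r : Fin (numRounds n η) => threshold n η r)
        (fun _ => ((a ∩ {j | level π j = π.length}).ncard : ℝ))
        {r | r = ⟨π.length, h⟩ ∧ b = true} {r | r = ⟨π.length, h⟩ ∧ b = false} := by
  ext s
  cases b
  · simp [comparisonEvent, ← Bool.not_eq_true, levelRandomizer_eq_true_iff, hi]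
  · simp [comparisonEvent, levelRandomizer_eq_true_iff, hi]

lemma isLocalRandomizer_levelRandomizer {n : ℕ} {ε η : ℝ} (hε : 0 < ε)
    (π : Transcript n (Seed n η) Bool) (h : π.length < numRounds n η) (i : Fin n) :
    IsLocalRandomizer ε (noiseLaw _ (4 / ε) (8 / ε)) (levelRandomizer n η π h i) := by
  have hexp : 1 ≤ ENNReal.ofReal (Real.exp ε) := by simpa using hε.le
  refine isDP_of_forall_fiber (fun _ => Set.to_countable _) (fun a b => ?_) fun a a' ha s₀ => ?_
  all_goals by_cases hi : level π i = π.length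
  · rw [setOf_levelRandomizer_eq h hi]
    exact measurableSet_comparisonEvent ..
  · simp only [levelRandomizer, if_neg hi]
    exact .const _
  · rw [setOf_levelRandomizer_eq h hi, setOf_levelRandomizer_eq h hi]
    refine (noiseLaw_comparisonEvent_le_of_subsingleton hε
      (c' := fun _ => ((a' ∩ {j | level π j = π.length}).ncard : ℝ)) ?_ (fun _ => ?_) ?_).trans ?_
    · exact Set.disjoint_left.2 fun r hr hr' => by simp_all
    · exact (abs_ncard_inter_sub_ncard_inter_le a a' _).trans_eq (by simp [ha])
    · exact fun r hr r' hr' => hr.1.trans hr'.1.symm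
    · gcongr
      linarith
  · simp only [levelRandomizer, if_neg hi]
    exact le_mul_of_one_le_left' hexp

/-- The set of nodes that are on level `r` at the beginning of round `r`. -/
def survivors {n : ℕ} (ε : ℝ) {η : ℝ} (G : SimpleGraph (Fin n)) (ω : Fin n → Seed n η) (r : ℕ) :
    Set (Fin n) :=
  {i | level ((kCoreProtocol n ε η).run G ω r) i = r}

variable {n : ℕ} {ε η : ℝ} {G : SimpleGraph (Fin n)} {ω : Fin n → Seed n η} {r t : ℕ}

lemma length_run_kCoreProtocol (ht : t ≤ numRounds n η) :
    ((kCoreProtocol n ε η).run G ω t).length = t := by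
  refine (length_run_eq_or_curator_eq_none _ G ω t).elim id fun h => ?_
  exact (length_run_le _ G ω t).antisymm (ht.trans (curator_kCoreProtocol_eq_none_iff.1 h))

lemma haltsWithin_numRounds : (kCoreProtocol n ε η).HaltsWithin (numRounds n η) := fun _ _ =>
  curator_kCoreProtocol_eq_none_iff.2 (length_run_kCoreProtocol le_rfl).ge

lemma antitone_survivors : Antitone (survivors ε G ω) := by
  intro r t hrt i (hi : level _ i = t)
  have hlen := (length_run_le (kCoreProtocol n ε η) G ω t).antisymm
    (hi.symm.le.trans List.countP_le_length)
  have hall := List.countP_eq_length.1 (hi.trans hlen.symm)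
  change level ((kCoreProtocol n ε η).run G ω r) i = r
  rw [← take_run _ G ω hrt, level,
    List.countP_eq_length.2 fun e he => hall e (List.mem_of_mem_take he), List.length_take, hlen,
    min_eq_left hrt]

lemma levelRandomizer_run_eq_true_iff (hr : r < numRounds n η)
    {h : ((kCoreProtocol n ε η).run G ω r).length < numRounds n η} {v : Fin n} {a : Set (Fin n)}
    {s : Seed n η} :
    levelRandomizer n η ((kCoreProtocol n ε η).run G ω r) h v a s = true ↔
      v ∈ survivors ε G ω r ∧
        threshold n η r + s.1 < ((a ∩ survivors ε G ω r).ncard : ℝ) + s.2 ⟨r, hr⟩ := by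
  rw [levelRandomizer_eq_true_iff]
  simp only [length_run_kCoreProtocol hr.le]
  rfl

lemma mem_survivors_succ_iff (hr : r < numRounds n η) {v : Fin n} :
    v ∈ survivors ε G ω (r + 1) ↔ v ∈ survivors ε G ω r ∧ threshold n η r + (ω v).1 <
      ((G.neighborSet v ∩ survivors ε G ω r).ncard : ℝ) + (ω v).2 ⟨r, hr⟩ := by
  have hlen := length_run_kCoreProtocol (ε := ε) (G := G) (ω := ω) hr.le
  have hlt : ((kCoreProtocol n ε η).run G ω r).length < numRounds n η := by rwa [hlen]
  have hle : level ((kCoreProtocol n ε η).run G ω r) v ≤ r :=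
    List.countP_le_length.trans_eq hlen
  rw [← levelRandomizer_run_eq_true_iff hr (h := hlt)]
  change level _ v = r + 1 ↔ _
  rw [run_succ_of_some (curator_kCoreProtocol_eq_some_iff.2 ⟨hlt, rfl⟩), level, List.countP_append]
  change level _ v + _ = _ ↔ _
  by_cases hout : levelRandomizer n η _ hlt v (G.neighborSet v) (ω v) = true
  · have hmem : level _ v = r := ((levelRandomizer_run_eq_true_iff hr).1 hout).1
    simp [play, hout, hmem]
  · simp [play, hout]
    omega

lemma survivors_zero : survivors ε G ω 0 = Set.univ :=
  Set.eq_univ_of_forall fun _ => rfl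

lemma mem_consistentSeeds_kCoreProtocol_iff {v : Fin n} {a : Set (Fin n)} {s : Seed n η} :
    s ∈ (kCoreProtocol n ε η).consistentSeeds G ω t v a ↔
      ∀ r : Fin (numRounds n η), r < t → (v ∈ survivors ε G ω r ∧ threshold n η r + s.1 <
        ((a ∩ survivors ε G ω r).ncard : ℝ) + s.2 r ↔ v ∈ survivors ε G ω (r + 1)) := by
  have hanswer : ∀ (r : Fin (numRounds n η)) (h), levelRandomizer n η
      ((kCoreProtocol n ε η).run G ω r) h v a s = levelRandomizer n η
        ((kCoreProtocol n ε η).run G ω r) h v (G.neighborSet v) (ω v) ↔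
      (v ∈ survivors ε G ω r ∧ threshold n η r + s.1 <
        ((a ∩ survivors ε G ω r).ncard : ℝ) + s.2 r ↔ v ∈ survivors ε G ω (r + 1)) := fun r h => by
    rw [Bool.eq_iff_iff, levelRandomizer_run_eq_true_iff r.2, levelRandomizer_run_eq_true_iff r.2,
      ← mem_survivors_succ_iff]
  refine ⟨fun hs r hr => ?_, fun hs r hr q hq _ => ?_⟩
  · exact (hanswer r ((length_run_kCoreProtocol r.2.le).trans_lt r.2)).1
      (hs r hr _ (curator_kCoreProtocol_eq_some_iff.2 ⟨_, rfl⟩) (Set.mem_univ v))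
  · have hlen : ((kCoreProtocol n ε η).run G ω r).length = r :=
      (length_run_eq_or_curator_eq_none _ G ω r).resolve_right (by simp [hq])
    obtain ⟨hN, rfl⟩ := curator_kCoreProtocol_eq_some_iff.1 hq
    exact (hanswer ⟨r, hlen ▸ hN⟩ hN).2 (hs ⟨r, hlen ▸ hN⟩ hr)

lemma consistentSeeds_kCoreProtocol (t : ℕ) (v : Fin n) (a : Set (Fin n)) :
    (kCoreProtocol n ε η).consistentSeeds G ω t v a =
      comparisonEvent (fun r : Fin (numRounds n η) => threshold n η r)
        (fun r => ((a ∩ survivors ε G ω r).ncard : ℝ))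
        {r | r < t ∧ v ∈ survivors ε G ω (r + 1)}
        {r | r < t ∧ v ∈ survivors ε G ω r \ survivors ε G ω (r + 1)} := by
  ext s
  rw [mem_consistentSeeds_kCoreProtocol_iff]
  refine ⟨fun hs => ⟨fun r hr => ((hs r hr.1).2 hr.2).2, fun r hr => ?_⟩, fun hs r hr => ?_⟩
  · exact not_lt.1 fun hlt => hr.2.2 ((hs r hr.1).1 ⟨hr.2.1, hlt⟩)
  · refine ⟨fun h => ?_, fun h => ⟨antitone_survivors (Nat.le_succ _) h, hs.1 r ⟨hr, h⟩⟩⟩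
    by_contra hv
    exact (hs.2 r ⟨hr, h.1, hv⟩).not_gt h.2

lemma isProbabilityMeasure_seedLaw_kCoreProtocol (hε : 0 < ε) (v : Fin n) :
    IsProbabilityMeasure ((kCoreProtocol n ε η).seedLaw v) :=
  isProbabilityMeasure_noiseLaw (by positivity) (by positivity)

lemma isProbabilityMeasure_law_kCoreProtocol (hε : 0 < ε) :
    IsProbabilityMeasure (kCoreProtocol n ε η).law :=
  have := fun v => isProbabilityMeasure_seedLaw_kCoreProtocol (n := n) (η := η) hε v
  inferInstanceAs (IsProbabilityMeasure (Measure.pi _))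

lemma isLEDP_kCoreProtocol (n : ℕ) (η : ℝ) (hε : 0 < ε) : (kCoreProtocol n ε η).IsLEDP ε := by
  have hprob := fun v => isProbabilityMeasure_seedLaw_kCoreProtocol (n := n) (η := η) hε v
  refine ⟨hprob, fun π q hq v _ => ?_, fun t => isDP_run (fun G ω v a => ?_)
    fun G ω v a a' ha => ?_⟩
  · obtain ⟨hπ, rfl⟩ := curator_kCoreProtocol_eq_some_iff.1 hq
    exact ⟨hε.le, isLocalRandomizer_levelRandomizer hε π hπ v⟩
  · rw [consistentSeeds_kCoreProtocol]
    exact measurableSet_comparisonEvent ..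
  · rw [consistentSeeds_kCoreProtocol, consistentSeeds_kCoreProtocol]
    refine noiseLaw_comparisonEvent_le_of_subsingleton hε ?_ (fun r => ?_) ?_
    · exact Set.disjoint_left.2 fun r hr hr' => hr'.2.2 hr.2
    · exact (abs_ncard_inter_sub_ncard_inter_le a a' _).trans_eq (by simp [ha])
    · rintro r ⟨-, hr⟩ r' ⟨-, hr'⟩
      by_contra hne
      rcases lt_or_gt_of_ne hne with hlt | hlt
      · exact hr.2 (antitone_survivors (Nat.succ_le_of_lt hlt) hr'.1)
      · exact hr'.2 (antitone_survivors (Nat.succ_le_of_lt hlt) hr.1)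

end Privacy

/-! ### Cores and noisy peelings -/

lemma sum_ncard_neighborSet_inter_insert_le {V : Type*} {G : SimpleGraph V} (u : V) (T : Set V)
    (R : Finset V) :
    ∑ x ∈ R, (G.neighborSet x ∩ insert u T).ncard ≤
      ∑ x ∈ R, (G.neighborSet x ∩ T).ncard + (G.neighborSet u ∩ R).ncard := by
  classical
  have hcount : (G.neighborSet u ∩ R).ncard = ∑ x ∈ R, if G.Adj u x then 1 else 0 := by
    rw [Finset.sum_boole, Nat.cast_id, ← Set.ncard_coe_finset, Finset.coe_filter]
    exact congrArg Set.ncard (Set.ext fun x => and_comm)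
  rw [hcount, ← Finset.sum_add_distrib]
  refine Finset.sum_le_sum fun x _ => ?_
  by_cases hux : G.Adj u x
  · rw [if_pos hux, Set.inter_insert_of_mem (show u ∈ G.neighborSet x from hux.symm)]
    exact Set.ncard_insert_le _ _
  · rw [if_neg hux, Set.inter_insert_of_notMem fun h : u ∈ G.neighborSet x => hux h.symm, add_zero]

section Cores

variable {V : Type} [Finite V] {G : SimpleGraph V} {k : ℕ}

lemma le_ncard_of_mem_kCore {u : V} (hu : u ∈ kCore G k) :
    k ≤ (G.neighborSet u ∩ kCore G k).ncard := by
  obtain ⟨S, hS, huS⟩ := hu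
  exact (hS u huS).trans (Set.ncard_le_ncard
    (Set.inter_subset_inter_right _ (Set.subset_sUnion_of_mem hS)) (Set.toFinite _))

lemma le_card_of_mem_kCore {u : V} (hu : u ∈ kCore G k) : k ≤ Nat.card V :=
  (le_ncard_of_mem_kCore hu).trans (Set.ncard_le_card _)

lemma bddAbove_setOf_mem_kCore (G : SimpleGraph V) (v : V) : BddAbove {k : ℕ | v ∈ kCore G k} :=
  ⟨Nat.card V, fun _ => le_card_of_mem_kCore⟩

lemma mem_kCore_coreNumber (G : SimpleGraph V) (v : V) : v ∈ kCore G (coreNumber G v) :=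
  Nat.sSup_mem (s := {k : ℕ | v ∈ kCore G k}) ⟨0, Set.univ, fun _ _ => Nat.zero_le _, trivial⟩
    (bddAbove_setOf_mem_kCore G v)

lemma notMem_kCore_coreNumber_succ (G : SimpleGraph V) (v : V) :
    v ∉ kCore G (coreNumber G v + 1) := fun h =>
  (Nat.lt_succ_self _).not_ge (le_csSup (bddAbove_setOf_mem_kCore G v) h)

lemma exists_ncard_inter_union_kCore_le {Q : Set V} (hQ : Q.Nonempty)
    (hdisj : Disjoint Q (kCore G (k + 1))) :
    ∃ u ∈ Q, (G.neighborSet u ∩ (Q ∪ kCore G (k + 1))).ncard ≤ k := by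
  by_contra! hcon
  obtain ⟨x, hx⟩ := hQ
  refine hdisj.notMem_of_mem_left hx ⟨Q ∪ kCore G (k + 1), ?_, Or.inl hx⟩
  rintro y (hy | hy)
  · exact hcon y hy
  · exact (le_ncard_of_mem_kCore hy).trans (Set.ncard_le_ncard
      (Set.inter_subset_inter_right _ Set.subset_union_right) (Set.toFinite _))

-- Peel off the vertices of `Q` one after the other, each with at most `k` remaining edges.
lemma sum_ncard_inter_union_kCore_le (Q : Finset V) (hQ : Disjoint (Q : Set V) (kCore G (k + 1))) :
    ∑ u ∈ Q, (G.neighborSet u ∩ (Q ∪ kCore G (k + 1))).ncard ≤ 2 * k * Q.card := by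
  classical
  induction hm : Q.card generalizing Q with
  | zero => simp [Finset.card_eq_zero.1 hm]
  | succ m ih =>
    obtain ⟨u, huQ, hu⟩ := exists_ncard_inter_union_kCore_le
      (Finset.coe_nonempty.2 (Finset.card_pos.1 (by omega))) hQ
    set H := kCore G (k + 1)
    have hrest : ∑ x ∈ Q.erase u, (G.neighborSet x ∩ ((Q.erase u : Finset V) ∪ H)).ncard ≤
        2 * k * m :=
      ih _ (hQ.mono_left (mod_cast Q.erase_subset u)) (by rw [Finset.card_erase_of_mem huQ]; omega)
    have hinsert : (Q : Set V) ∪ H = insert u (((Q.erase u : Finset V) : Set V) ∪ H) := by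
      rw [← Set.insert_union, ← Finset.coe_insert, Finset.insert_erase huQ]
    have hnbr : (G.neighborSet u ∩ (Q.erase u : Finset V)).ncard ≤ k :=
      (Set.ncard_le_ncard (Set.inter_subset_inter_right _ (Set.subset_union_of_subset_left
        (mod_cast Q.erase_subset u) H)) (Set.toFinite _)).trans hu
    calc ∑ x ∈ Q, (G.neighborSet x ∩ (Q ∪ H)).ncard
        = (G.neighborSet u ∩ (Q ∪ H)).ncard +
            ∑ x ∈ Q.erase u, (G.neighborSet x ∩ insert u ((Q.erase u : Finset V) ∪ H)).ncard := by
          rw [← Finset.add_sum_erase Q _ huQ, hinsert]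
      _ ≤ k + (2 * k * m + k) := add_le_add hu
          ((sum_ncard_neighborSet_inter_insert_le _ _ _).trans (add_le_add hrest hnbr))
      _ = 2 * k * (m + 1) := by ring

lemma mul_ncard_sdiff_kCore_le {γ : ℝ} {Z Z' : Set V} (hZ : Z' ⊆ Z)
    (hd : ∀ u ∈ Z', 2 * γ * k < ((G.neighborSet u ∩ Z).ncard : ℝ)) :
    γ * ((Z' \ kCore G (k + 1)).ncard : ℝ) ≤ ((Z \ kCore G (k + 1)).ncard : ℝ) := by
  set H := kCore G (k + 1)
  obtain hempty | hne := (Z' \ H).eq_empty_or_nonempty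
  · simp [hempty]
  lift Z \ H to Finset V using Set.toFinite _ with Q hQ
  lift Z' \ H to Finset V using Set.toFinite _ with Q' hQ'
  have hQQ : Q' ⊆ Q := by
    rw [← Finset.coe_subset, hQ, hQ']
    exact Set.sdiff_subset_sdiff_left hZ
  have hcover : Z ⊆ Q ∪ H := by
    rw [hQ, Set.sdiff_union_self]
    exact Set.subset_union_left
  have hsum : (Q'.card : ℝ) * (2 * γ * k) < 2 * k * Q.card := by
    calc (Q'.card : ℝ) * (2 * γ * k)
        < ∑ u ∈ Q', ((G.neighborSet u ∩ (Q ∪ H)).ncard : ℝ) := by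
          rw [← nsmul_eq_mul, ← Finset.sum_const]
          refine Finset.sum_lt_sum_of_nonempty (Finset.coe_nonempty.1 hne) fun u hu => ?_
          refine (hd u (hQ'.subset hu).1).trans_le (mod_cast Set.ncard_le_ncard
            (Set.inter_subset_inter_right _ hcover) (Set.toFinite _))
      _ ≤ ∑ u ∈ Q, ((G.neighborSet u ∩ (Q ∪ H)).ncard : ℝ) :=
          Finset.sum_le_sum_of_subset_of_nonneg hQQ fun _ _ _ => Nat.cast_nonneg _
      _ ≤ 2 * k * Q.card :=
          mod_cast sum_ncard_inter_union_kCore_le Q (hQ ▸ Set.disjoint_sdiff_left)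
  rw [Set.ncard_coe_finset, Set.ncard_coe_finset]
  refine (lt_of_mul_lt_mul_left (a := 2 * (k : ℝ)) ?_ (by positivity)).le
  linarith

end Cores

/-- The sets `W 0 ⊇ W 1 ⊇ …` arise from `W 0 = V` by peeling: in round `r < N` the set `W (r + 1)`
is obtained from `W r` by comparing the number of neighbours in `W r` of each vertex with the
threshold `θ r`, where each comparison may be wrong if the two numbers differ by at most `D`. -/
structure NoisyPeeling {V : Type} (G : SimpleGraph V) (θ : ℕ → ℝ) (D : ℝ) (N : ℕ)
    (W : ℕ → Set V) : Prop where
  zero : W 0 = Set.univ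
  anti : Antitone W
  lt_of_mem : ∀ r < N, ∀ i ∈ W (r + 1), θ r - D < ((G.neighborSet i ∩ W r).ncard : ℝ)
  le_of_notMem : ∀ r < N, ∀ i ∈ W r \ W (r + 1), ((G.neighborSet i ∩ W r).ncard : ℝ) ≤ θ r + D

namespace NoisyPeeling

variable {V : Type} [Finite V] {G : SimpleGraph V} {θ : ℕ → ℝ} {D : ℝ} {N : ℕ} {W : ℕ → Set V}
  {k m : ℕ}

lemma kCore_subset (hW : NoisyPeeling G θ D N W) (hm : m ≤ N) (hk : ∀ r < m, θ r + D < k) :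
    kCore G k ⊆ W m := by
  induction m with
  | zero => exact hW.zero ▸ Set.subset_univ _
  | succ m ih =>
    have hsub : kCore G k ⊆ W m := ih (by omega) fun r hr => hk r (by omega)
    intro i hi
    by_contra hnot
    have hdeg : (k : ℝ) ≤ (G.neighborSet i ∩ W m).ncard :=
      mod_cast (le_ncard_of_mem_kCore hi).trans (Set.ncard_le_ncard
        (Set.inter_subset_inter_right _ hsub) (Set.toFinite _))
    linarith [hW.le_of_notMem m hm i ⟨hsub hi, hnot⟩, hk m m.lt_succ_self]

lemma pow_mul_ncard_sdiff_kCore_le (hW : NoisyPeeling G θ D N W) {γ : ℝ} (hγ : 0 ≤ γ) {a : ℕ}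
    (hm : a + m ≤ N) (hk : ∀ s < m, 2 * γ * k < θ (a + s) - D) :
    γ ^ m * ((W (a + m) \ kCore G (k + 1)).ncard : ℝ) ≤ ((W a \ kCore G (k + 1)).ncard : ℝ) := by
  induction m with
  | zero => simp
  | succ m ih =>
    have hstep : γ * ((W (a + (m + 1)) \ kCore G (k + 1)).ncard : ℝ) ≤
        ((W (a + m) \ kCore G (k + 1)).ncard : ℝ) :=
      mul_ncard_sdiff_kCore_le (hW.anti (by omega)) fun u hu =>
        (hk m m.lt_succ_self).trans (hW.lt_of_mem _ (by omega) u hu)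
    rw [pow_succ, mul_assoc]
    exact (mul_le_mul_of_nonneg_left hstep (by positivity)).trans
      (ih (by omega) fun s hs => hk s (by omega))

lemma subset_kCore (hW : NoisyPeeling G θ D N W) {γ : ℝ} (hγ : 0 ≤ γ) {a : ℕ}
    (hm : a + m ≤ N) (hk : ∀ s < m, 2 * γ * k < θ (a + s) - D) (hcard : Nat.card V < γ ^ m) :
    W (a + m) ⊆ kCore G (k + 1) := by
  rw [← Set.sdiff_eq_empty, ← Set.ncard_eq_zero (Set.toFinite _)]
  by_contra hne
  have hone : (1 : ℝ) ≤ (W (a + m) \ kCore G (k + 1)).ncard :=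
    mod_cast Nat.one_le_iff_ne_zero.2 hne
  have hall : ((W a \ kCore G (k + 1)).ncard : ℝ) ≤ Nat.card V := mod_cast Set.ncard_le_card _
  have hpow := (hW.pow_mul_ncard_sdiff_kCore_le hγ hm hk).trans hall
  exact (hcard.trans_le (le_mul_of_one_le_right (by positivity) hone)).not_ge hpow

end NoisyPeeling

/-! ### Accuracy under bounded noise -/

section Parameters

variable {n : ℕ} {η : ℝ}

lemma psi_pos (hη : 0 < η) : 0 < psi η := by unfold psi; positivity

lemma two_add_lam_mul (hη : 0 < η) : (2 + lam η) * (1 + psi η) ^ 2 = 2 + η := by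
  unfold lam psi
  have : η + 10 ≠ 0 := by positivity
  field_simp
  ring

-- Equivalently `2 (1 + ψ)³ ≤ 2 + η`; this is where `η ≤ 5` enters.
lemma one_add_psi_le (hη : 0 < η) (hη5 : η ≤ 5) : 1 + psi η ≤ (2 + lam η) / 2 := by
  have hψ := psi_pos hη
  have hcube : 2 * (1 + psi η) * (1 + psi η) ^ 2 ≤ (2 + lam η) * (1 + psi η) ^ 2 := by
    rw [two_add_lam_mul hη]
    unfold psi
    nlinarith [mul_nonneg hη.le (sub_nonneg.2 hη5),
      mul_nonneg hη.le (mul_nonneg hη.le (sub_nonneg.2 hη5))]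
  linarith [le_of_mul_le_mul_right hcube (by positivity)]

lemma one_le_two_add_lam_div_two (hη : 0 < η) (hη5 : η ≤ 5) : 1 ≤ (2 + lam η) / 2 :=
  (le_add_of_nonneg_right (psi_pos hη).le).trans (one_add_psi_le hη hη5)

lemma le_pow_logCeil (hη : 0 < η) (hn : 0 < n) : (n : ℝ) ≤ (1 + psi η) ^ logCeil n η := by
  have hceil : Real.logb (1 + psi η) n ≤ (logCeil n η : ℝ) := Nat.le_ceil _
  rwa [Real.logb_le_iff_le_rpow (by linarith [psi_pos hη]) (by exact_mod_cast hn),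
    Real.rpow_natCast] at hceil

lemma logCeil_pos (hη : 0 < η) (hn : 2 ≤ n) : 0 < logCeil n η :=
  Nat.ceil_pos.2 (Real.logb_pos (by linarith [psi_pos hη]) (by exact_mod_cast hn))

lemma exists_logCeil_le (hη : 0 < η) :
    ∃ C : ℝ, ∀ n : ℕ, (logCeil n η : ℝ) ≤ C * Real.log n := by
  have hlogψ : 0 < Real.log (1 + psi η) := Real.log_pos (by linarith [psi_pos hη])
  have hlog2 : 0 < Real.log 2 := Real.log_pos (by norm_num)
  refine ⟨1 / Real.log (1 + psi η) + 1 / Real.log 2, fun n => ?_⟩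
  obtain hn | hn := Nat.lt_or_ge n 2
  · interval_cases n <;> simp [logCeil]
  have hlogn : Real.log 2 ≤ Real.log n := Real.log_le_log (by norm_num) (by exact_mod_cast hn)
  have hlogb : Real.logb (1 + psi η) n = 1 / Real.log (1 + psi η) * Real.log n := by
    rw [Real.logb, one_div_mul_eq_div]
  have hone : 1 ≤ 1 / Real.log 2 * Real.log n := by
    rwa [one_div_mul_eq_div, one_le_div hlog2]
  calc (logCeil n η : ℝ) ≤ Real.logb (1 + psi η) n + 1 :=
        (Nat.ceil_lt_add_one (hlogb ▸ by positivity)).le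
    _ ≤ _ := by rw [add_mul, hlogb]; gcongr

lemma exists_numRounds_le (hη : 0 < η) :
    ∃ C : ℝ, 0 ≤ C ∧ ∀ n : ℕ, (numRounds n η : ℝ) ≤ C * Real.log n ^ 2 := by
  obtain ⟨C, hlog⟩ := exists_logCeil_le hη
  refine ⟨(4 * C) ^ 2, by positivity, fun n => ?_⟩
  rw [← mul_pow, numRounds, groupSize, Nat.cast_pow, Nat.cast_mul, Nat.cast_ofNat, mul_assoc]
  gcongr
  exact hlog n

end Parameters

namespace NoisyPeeling

variable {n : ℕ} {η D : ℝ} {G : SimpleGraph (Fin n)} {W : ℕ → Set (Fin n)} {v : Fin n} {l : ℕ}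

lemma coreNumber_sub_le (hW : NoisyPeeling G (threshold n η) D (numRounds n η) W) (hη : 0 < η)
    (hη5 : η ≤ 5) (hn : 2 ≤ n) (hD : 0 ≤ D) (hl : ∀ m ≤ numRounds n η, v ∈ W m → m ≤ l) :
    (coreNumber G v : ℝ) - D ≤
      (2 + lam η) / 2 * (1 + psi η) ^ ((l + 1) / groupSize n η - 1) := by
  set p := (l + 1) / groupSize n η - 1 with hp
  have hbase : 1 ≤ 1 + psi η := by linarith [psi_pos hη]
  have hg : groupSize n η = 4 * logCeil n η := rfl
  have hg0 : 0 < groupSize n η := by have := logCeil_pos hη hn; omega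
  by_contra! hcon
  have hpow : (1 + psi η) ^ (p + 1) + D < coreNumber G v := by
    have := mul_le_mul_of_nonneg_right (one_add_psi_le hη hη5) (by positivity : 0 ≤ (1 + psi η) ^ p)
    rw [pow_succ']
    linarith
  obtain hpg | hpg := le_or_gt (groupSize n η) (p + 1)
  · have hkn : (coreNumber G v : ℝ) ≤ n := by
      simpa using le_card_of_mem_kCore (mem_kCore_coreNumber G v)
    have hnp : (n : ℝ) ≤ (1 + psi η) ^ (p + 1) :=
      (le_pow_logCeil hη (by omega)).trans (pow_le_pow_right₀ hbase (by omega))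
    linarith
  · have hrounds : (p + 2) * groupSize n η ≤ numRounds n η := by
      rw [numRounds, sq]
      exact Nat.mul_le_mul_right _ hpg
    have hthreshold : ∀ r < (p + 2) * groupSize n η, threshold n η r + D < coreNumber G v := by
      intro r hr
      have hle : threshold n η r ≤ (1 + psi η) ^ (p + 1) :=
        pow_le_pow_right₀ hbase (Nat.lt_succ_iff.1 ((Nat.div_lt_iff_lt_mul hg0).2 hr))
      linarith
    have hmem := hW.kCore_subset hrounds hthreshold (mem_kCore_coreNumber G v)
    have hdiv : p + 2 ≤ (l + 1) / groupSize n η :=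
      (Nat.le_div_iff_mul_le hg0).2 ((hl _ hrounds hmem).trans (Nat.le_succ l))
    exact (Nat.sub_le_iff_le_add.1 hp.ge).not_gt hdiv

lemma estimate_le (hW : NoisyPeeling G (threshold n η) D (numRounds n η) W) (hη : 0 < η)
    (hη5 : η ≤ 5) (hn : 2 ≤ n) (hlN : l ≤ numRounds n η) (hv : v ∈ W l) :
    (2 + lam η) / 2 * (1 + psi η) ^ ((l + 1) / groupSize n η - 1) ≤
      (2 + η) * coreNumber G v + (2 + lam η) / 2 * max D 1 := by
  have hlam := one_le_two_add_lam_div_two hη hη5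
  have hψ := psi_pos hη
  have hL := logCeil_pos hη hn
  have hg : groupSize n η = 4 * logCeil n η := rfl
  obtain hp | _ := Nat.eq_zero_or_pos ((l + 1) / groupSize n η - 1)
  · rw [hp, pow_zero]
    exact (mul_le_mul_of_nonneg_left (le_max_right _ _) (by linarith)).trans
      (le_add_of_nonneg_left (by positivity))
  have hwindow : ((l + 1) / groupSize n η - 1 + 1) * groupSize n η ≤ l + 1 := by
    rw [Nat.sub_add_cancel (by omega)]
    exact Nat.div_mul_le_self _ _
  generalize (l + 1) / groupSize n η - 1 = p at *
  rw [add_mul, one_mul] at hwindow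
  by_contra! hcon
  have hgap : 2 * (1 + psi η) ^ 2 * coreNumber G v < (1 + psi η) ^ p - D := by
    rw [← two_add_lam_mul hη] at hcon
    have hlt : 2 * (1 + psi η) ^ 2 * coreNumber G v + max D 1 < (1 + psi η) ^ p :=
      lt_of_mul_lt_mul_left (a := (2 + lam η) / 2) (by linarith) (by linarith)
    linarith [le_max_left D 1]
  have hthreshold : ∀ s < groupSize n η - 1,
      threshold n η (p * groupSize n η + s) = (1 + psi η) ^ p := by
    intro s hs
    rw [threshold, mul_comm, Nat.mul_add_div (by omega), Nat.div_eq_of_lt (by omega), add_zero]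
  have hcard : (Nat.card (Fin n) : ℝ) < ((1 + psi η) ^ 2) ^ (groupSize n η - 1) := by
    rw [Nat.card_fin, ← pow_mul]
    exact (le_pow_logCeil hη (by omega)).trans_lt (pow_lt_pow_right₀ (by linarith) (by omega))
  have hsub := hW.subset_kCore (by positivity) (by omega)
    (fun s hs => (hthreshold s hs).symm ▸ hgap) hcard
  exact notMem_kCore_coreNumber_succ G v (hsub (hW.anti (by omega) hv))

end NoisyPeeling

section Run

variable {n : ℕ} {ε η B : ℝ} {G : SimpleGraph (Fin n)} {ω : Fin n → Seed n η}

lemma noisyPeeling_survivors (hthr : ∀ i, |(ω i).1| ≤ B) (hround : ∀ i r, |(ω i).2 r| ≤ B) :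
    NoisyPeeling G (threshold n η) (2 * B) (numRounds n η) (survivors ε G ω) where
  zero := survivors_zero
  anti := antitone_survivors
  lt_of_mem r hr i hi := by
    have hlt := ((mem_survivors_succ_iff hr).1 hi).2
    linarith [(abs_le.1 (hthr i)).1, (abs_le.1 (hround i ⟨r, hr⟩)).2]
  le_of_notMem r hr i hi := by
    have hle := not_lt.1 fun h => hi.2 ((mem_survivors_succ_iff hr).2 ⟨hi.1, h⟩)
    linarith [(abs_le.1 (hthr i)).2, (abs_le.1 (hround i ⟨r, hr⟩)).1]

lemma isGreatest_topLevel (i : Fin n) :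
    IsGreatest {r | r ≤ numRounds n η ∧ i ∈ survivors ε G ω r}
      (topLevel ((kCoreProtocol n ε η).run G ω (numRounds n η)) i) := by
  have htake : ∀ r ≤ numRounds n η,
      (level (((kCoreProtocol n ε η).run G ω (numRounds n η)).take r) i = r ↔
        i ∈ survivors ε G ω r) := fun r hr => by
    rw [take_run _ G ω hr]
    rfl
  unfold topLevel
  rw [length_run_kCoreProtocol le_rfl]
  refine ⟨⟨Nat.findGreatest_le _, (htake _ (Nat.findGreatest_le _)).1 ?_⟩, fun r hr =>
    Nat.le_findGreatest hr.1 ((htake r hr.1).2 hr.2)⟩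
  exact Nat.findGreatest_spec (P := fun r =>
    level (((kCoreProtocol n ε η).run G ω (numRounds n η)).take r) i = r) (Nat.zero_le _) rfl

lemma isApproxCore_kCoreOutput (hη : 0 < η) (hη5 : η ≤ 5) (hn : 2 ≤ n)
    (hthr : ∀ i, |(ω i).1| ≤ B) (hround : ∀ i r, |(ω i).2 r| ≤ B) :
    IsApproxCore (2 + η) ((2 + lam η) / 2 * max (2 * B) 1) G (kCoreOutput n ε η G ω) := by
  intro v
  have hW := noisyPeeling_survivors (ε := ε) (G := G) hthr hround
  have hB : 0 ≤ B := (abs_nonneg _).trans (hthr v)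
  obtain ⟨⟨hle, hmem⟩, hmax⟩ := isGreatest_topLevel (ε := ε) (G := G) (ω := ω) v
  refine ⟨?_, hW.estimate_le hη hη5 hn hle hmem⟩
  have hζ : 2 * B ≤ (2 + lam η) / 2 * max (2 * B) 1 :=
    (le_max_left _ _).trans (le_mul_of_one_le_left (by positivity)
      (one_le_two_add_lam_div_two hη hη5))
  exact (sub_le_sub_left hζ _).trans
    (hW.coreNumber_sub_le hη hη5 hn (by positivity) fun r hr hv => hmax ⟨hr, hv⟩)

end Run

/-! ### Accuracy with high probability -/

lemma IsApproxCore.mono {V : Type} {G : SimpleGraph V} {est : V → ℝ} {φ φ' ζ ζ' : ℝ}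
    (h : IsApproxCore φ ζ G est) (hφ : φ ≤ φ') (hζ : ζ ≤ ζ') : IsApproxCore φ' ζ' G est := by
  refine fun v => ⟨by linarith [(h v).1], (h v).2.trans ?_⟩
  gcongr

lemma law_exists_lt_abs_le {n : ℕ} {ε η B : ℝ} (hε : 0 < ε) (hB : 0 ≤ B) :
    (kCoreProtocol n ε η).law.real {ω | ∃ i, B < |(ω i).1| ∨ ∃ r, B < |(ω i).2 r|} ≤
      n * (1 + numRounds n η) * Real.exp (-(B * ε / 8)) := by
  have := fun v => isProbabilityMeasure_seedLaw_kCoreProtocol (n := n) (η := η) hε v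
  have hnode : noiseLaw (Fin (numRounds n η)) (4 / ε) (8 / ε)
      {s | B < |s.1| ∨ ∃ r, B < |s.2 r|} ≤
        ENNReal.ofReal ((1 + numRounds n η) * Real.exp (-(B * ε / 8))) := by
    refine (noiseLaw_exists_lt_abs_le (by positivity) (by positivity) hB).trans ?_
    rw [Fintype.card_fin, one_add_mul, neg_div, neg_div, div_div_eq_mul_div, div_div_eq_mul_div]
    gcongr
    norm_num
  refine ENNReal.toReal_le_of_le_ofReal (by positivity) ?_
  calc (kCoreProtocol n ε η).law {ω | ∃ i, B < |(ω i).1| ∨ ∃ r, B < |(ω i).2 r|}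
      = (kCoreProtocol n ε η).law
          (⋃ i, Function.eval i ⁻¹' {s | B < |s.1| ∨ ∃ r, B < |s.2 r|}) := by
        congr 1; ext ω; simp
    _ ≤ ∑ _ : Fin n, ENNReal.ofReal ((1 + numRounds n η) * Real.exp (-(B * ε / 8))) :=
        (pi_iUnion_eval_preimage_le _).trans (Finset.sum_le_sum fun _ _ => hnode)
    _ = _ := by
        rw [← ENNReal.ofReal_sum_of_nonneg fun _ _ => by positivity]
        simp [mul_assoc]

lemma one_sub_le_law_isApproxCore {n : ℕ} {ε η B : ℝ} (hη : 0 < η) (hη5 : η ≤ 5) (hn : 2 ≤ n)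
    (hε : 0 < ε) (hB : 0 ≤ B) (G : SimpleGraph (Fin n)) :
    1 - n * (1 + numRounds n η) * Real.exp (-(B * ε / 8)) ≤ (kCoreProtocol n ε η).law.real
      {ω | IsApproxCore (2 + η) ((2 + lam η) / 2 * max (2 * B) 1) G (kCoreOutput n ε η G ω)} := by
  have := isProbabilityMeasure_law_kCoreProtocol (n := n) (η := η) hε
  have hcover : Set.univ ⊆ {ω | IsApproxCore (2 + η) ((2 + lam η) / 2 * max (2 * B) 1) G
      (kCoreOutput n ε η G ω)} ∪ {ω | ∃ i, B < |(ω i).1| ∨ ∃ r, B < |(ω i).2 r|} := by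
    intro ω _
    refine or_iff_not_imp_right.2 fun hω => ?_
    simp only [Set.mem_ofPred_eq, not_exists, not_or, not_lt] at hω
    exact isApproxCore_kCoreOutput hη hη5 hn (fun i => (hω i).1) fun i => (hω i).2
  have htotal := (measureReal_mono (μ := (kCoreProtocol n ε η).law) hcover).trans
    (measureReal_union_le _ _)
  rw [probReal_univ] at htotal
  linarith [law_exists_lt_abs_le (n := n) (η := η) hε hB]

lemma mul_exp_neg_log_le {x N C c : ℝ} (hx : 1 ≤ x) (hC : 0 ≤ C) (hN : N ≤ C * Real.log x ^ 2) :
    x * (1 + N) * Real.exp (-((c + 3) * Real.log x)) ≤ (1 + C) / x ^ c := by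
  have hx0 : 0 < x := one_pos.trans_le hx
  have hexp : Real.exp (-((c + 3) * Real.log x)) = (x ^ c * x ^ 3)⁻¹ := by
    rw [Real.exp_neg, mul_comm, ← Real.rpow_def_of_pos hx0, Real.rpow_add hx0]
    norm_cast
  have hlog : Real.log x ^ 2 ≤ x ^ 2 :=
    pow_le_pow_left₀ (Real.log_nonneg hx) (Real.log_le_self hx0.le) 2
  have hrounds : 1 + N ≤ (1 + C) * x ^ 2 := by
    linarith [one_le_pow₀ hx (n := 2), mul_le_mul_of_nonneg_left hlog hC]
  calc x * (1 + N) * Real.exp (-((c + 3) * Real.log x))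
      ≤ x * ((1 + C) * x ^ 2) * (x ^ c * x ^ 3)⁻¹ := by rw [hexp]; gcongr
    _ = (1 + C) / x ^ c := by field_simp

-- A comparison fails with probability `n⁻ᶜ⁻³` at noise level `B`, and there are `O(n³)` of them.
lemma exists_isApproxCore {η c : ℝ} (hη : 0 < η) (hη5 : η ≤ 5) (hc : 0 ≤ c) :
    ∃ K C : ℝ, ∀ (n : ℕ) (ε : ℝ), 2 ≤ n → 0 < ε → ∀ G : SimpleGraph (Fin n),
      1 - C / (n : ℝ) ^ c ≤ (kCoreProtocol n ε η).law.real
        {ω | IsApproxCore (2 + η) (K * max (Real.log n / ε) 1) G (kCoreOutput n ε η G ω)} := by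
  obtain ⟨C₀, hC₀, hrounds⟩ := exists_numRounds_le hη
  refine ⟨(2 + lam η) / 2 * (16 * (c + 3)), 1 + C₀, fun n ε hn hε G => ?_⟩
  have hn1 : (1 : ℝ) ≤ n := by exact_mod_cast (by omega : 1 ≤ n)
  have := isProbabilityMeasure_law_kCoreProtocol (n := n) (η := η) hε
  set B : ℝ := 8 * (c + 3) * Real.log n / ε with hB
  have hζ : (2 + lam η) / 2 * max (2 * B) 1 ≤
      (2 + lam η) / 2 * (16 * (c + 3)) * max (Real.log n / ε) 1 := by
    have hlam := one_le_two_add_lam_div_two hη hη5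
    rw [mul_assoc, mul_max_of_nonneg _ _ (by positivity : 0 ≤ 16 * (c + 3))]
    refine mul_le_mul_of_nonneg_left (max_le_max (le_of_eq ?_) (by linarith)) (by linarith)
    rw [hB]
    ring
  calc 1 - (1 + C₀) / (n : ℝ) ^ c
      ≤ 1 - n * (1 + numRounds n η) * Real.exp (-(B * ε / 8)) := by
        rw [show B * ε / 8 = (c + 3) * Real.log n by rw [hB]; field_simp]
        exact sub_le_sub_left (mul_exp_neg_log_le hn1 hC₀ (hrounds n)) 1
    _ ≤ _ := one_sub_le_law_isApproxCore hη hη5 hn hε (by positivity) G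
    _ ≤ _ := measureReal_mono fun _ hω => IsApproxCore.mono hω le_rfl hζ

end LEDPCore

theorem mainTheorem5 (η : ℝ) (hη : 0 < η) :
    (∀ (n : ℕ) (ε : ℝ), 0 < ε → (LEDPCore.kCoreProtocol n ε (min η 5)).IsLEDP ε) ∧
    (∃ C : ℝ, ∀ (n : ℕ) (ε : ℝ), 0 < ε →
      (LEDPCore.kCoreProtocol n ε (min η 5)).HaltsWithin (LEDPCore.numRounds n (min η 5)) ∧
      (LEDPCore.numRounds n (min η 5) : ℝ) ≤ C * Real.log n ^ 2) ∧
    (∀ c : ℝ, 1 ≤ c → ∃ K C : ℝ, ∀ (n : ℕ) (ε : ℝ), 2 ≤ n → 0 < ε →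
      ∀ G : SimpleGraph (Fin n),
        1 - C / (n : ℝ) ^ c ≤
          (LEDPCore.kCoreProtocol n ε (min η 5)).law.real
            {ω | LEDPCore.IsApproxCore (2 + η) (K * max (Real.log n / ε) 1) G
              (LEDPCore.kCoreOutput n ε (min η 5) G ω)}) := by
  have h0 : 0 < min η 5 := lt_min hη (by norm_num)
  refine ⟨fun n ε hε => LEDPCore.isLEDP_kCoreProtocol n _ hε, ?_, fun c hc => ?_⟩
  · obtain ⟨C, -, hC⟩ := LEDPCore.exists_numRounds_le h0
    exact ⟨C, fun n ε _ => ⟨LEDPCore.haltsWithin_numRounds, hC n⟩⟩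
  · obtain ⟨K, C, hKC⟩ :=
      LEDPCore.exists_isApproxCore h0 (min_le_right _ _) (zero_le_one.trans hc)
    refine ⟨K, C, fun n ε hn hε G => (hKC n ε hn hε G).trans ?_⟩
    have := LEDPCore.isProbabilityMeasure_law_kCoreProtocol (n := n) (η := min η 5) hε
    exact measureReal_mono fun ω hω =>
      LEDPCore.IsApproxCore.mono hω (by gcongr; exact min_le_left _ _) le_rfl
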